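/- All graphs are finite and simple. For a graph $G$, a colouring $f:V(G)\to\{1,\dots,k\}$ \emph{distinguishes} $G$ if for every nontrivial automorphism $\phi$ of $G$ there is a vertex $v$ with $f(v)\ne f(\phi(v))$; the distinguishing number $D(G)$ is the least $k$ for which such an $f$ exists. $L(G)$ denotes the line graph of $G$. Let $T$ be a tree that does not consist of a single edge (that is, $|V(T)|\neq 2$), let $C$ be its centre (the set of vertices of minimum eccentricity), and let $k=D(T)$. The \emph{branches} of $T$ are the connected components $S$ of $T-C$, each rooted at its unique vertex $v_S$ adjacent to a vertex of $C$; a branch is \emph{at} $c\in C$ if $v_S$ is adjacent to $c$. Call two branches $S,S'$ equivalent if there is a graph isomorphism $S\to S'$ sending $v_S$ to $v_{S'}$, and let $P_1,\dots,P_r$ be the equivalence classes. For a branch $S$, let $A_S$ be the group of automorphisms of $S$ fixing $v_S$. Consider the colourings $f:V(S)\to\{1,\dots,k\}$ such that for every nontrivial $\phi\in A_S$ there is $v\in V(S)$ with $f(v)\neq f(\phi(v))$; call two such colourings $f_1,f_2$ equivalent if there is $\phi\in A_S$ with $f_1(v)=f_2(\phi(v))$ for all $v\in V(S)$; and let $D(S;k)$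 be the number of equivalence classes of such colourings. This number depends only on the class $P_i$ of $S$; put $m_i=D(S;k)$ for $S\in P_i$. Then $D(T)<D(L(T))$ if and only if $C=\{u,w\}$ is an edge of $T$ and, for every $i$, exactly $m_i$ of the branches in $P_i$ are at $u$ and exactly $m_i$ of them are at $w$. -/

import Mathlib

namespace TreeDist

/-- A colouring `f` distinguishes `G` if every nontrivial automorphism of `G` changes the
colour of some vertex. -/
def Distinguishes {V : Type*} (G : SimpleGraph V) {α : Type*} (f : V → α) : Prop :=
  ∀ φ : G ≃g G, φ ≠ 1 → ∃ v, f v ≠ f (φ v)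

/-- The distinguishing number `D(G)`: the least number of colours with which some colouring
distinguishes `G`. (The set is non-empty for every finite graph.) -/
noncomputable def distNumber {V : Type*} (G : SimpleGraph V) : ℕ :=
  sInf {k : ℕ | ∃ f : V → Fin k, Distinguishes G f}

/-- A colouring `f` distinguishes the rooted graph `(G, r)` if every nontrivial automorphism of
`G` that fixes the root `r` changes the colour of some vertex. -/
def RootedDistinguishes {V : Type*} (G : SimpleGraph V) (r : V) {α : Type*} (f : V → α) : Prop :=
  ∀ φ : G ≃g G, φ r = r → φ ≠ 1 → ∃ v, f v ≠ f (φ v)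

/-- Two `k`-colourings distinguishing `(G, r)` are equivalent if a root-fixing automorphism
carries one to the other. -/
def rootedColouringSetoid {V : Type*} (G : SimpleGraph V) (r : V) (k : ℕ) :
    Setoid {f : V → Fin k // RootedDistinguishes G r f} where
  r f₁ f₂ := ∃ φ : G ≃g G, φ r = r ∧ ∀ v, f₁.1 v = f₂.1 (φ v)
  iseqv :=
    { refl := fun _ => ⟨RelIso.refl _, rfl, fun _ => rfl⟩
      symm := fun ⟨φ, hφ, h⟩ =>
        ⟨φ.symm, by rw [RelIso.symm_apply_eq, hφ], fun v => by rw [h, RelIso.apply_symm_apply]⟩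
      trans := fun ⟨φ, hφ, h⟩ ⟨ψ, hψ, h'⟩ =>
        ⟨φ.trans ψ, by simp [hφ, hψ], fun v => by rw [h, h']; rfl⟩ }

/-- `D(G, r; k)`: the number of inequivalent `k`-colourings distinguishing `(G, r)`. -/
noncomputable def rootedCount {V : Type*} (G : SimpleGraph V) (r : V) (k : ℕ) : ℕ :=
  Nat.card (Quotient (rootedColouringSetoid G r k))

/-- A branch of `T`: a connected component of `T - C(T)`, where `C(T)` is the centre of `T`,
together with its vertex adjacent to the centre (the root). In a tree every component of
`T - C(T)` has exactly one such vertex, so branches correspond to components. -/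
@[ext]
structure Branch {V : Type*} (T : SimpleGraph V) where
  /-- the component -/
  comp : (T.induce (T.centerᶜ)).ConnectedComponent
  /-- the root -/
  root : comp.supp
  /-- the root is adjacent to a central vertex -/
  adj_center : ∃ c ∈ T.center, T.Adj root.1.1 c

/-- The branch as a graph: the subgraph of `T` induced on the vertices of the component. -/
def Branch.graph {V : Type*} {T : SimpleGraph V} (S : Branch T) : SimpleGraph S.comp.supp :=
  (T.induce (T.centerᶜ)).induce S.comp.supp

/-- Two branches are equivalent if there is an isomorphism between them that sends root to
root. -/
def branchSetoid {V : Type*} (T : SimpleGraph V) : Setoid (Branch T) where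
  r S S' := ∃ β : S.graph ≃g S'.graph, β S.root = S'.root
  iseqv :=
    { refl := fun _ => ⟨RelIso.refl _, rfl⟩
      symm := fun ⟨β, h⟩ => ⟨β.symm, by rw [RelIso.symm_apply_eq, h]⟩
      trans := fun ⟨β, h⟩ ⟨β', h'⟩ => ⟨β.trans β', by simp [h, h']⟩ }

/-- The branches of `T` that are attached at the vertex `u`. -/
def branchesAt {V : Type*} (T : SimpleGraph V) (u : V) : Set (Branch T) :=
  {S | T.Adj S.root.1.1 u}

end TreeDist

namespace TreeDist

open SimpleGraph

variable {V : Type*} {T : SimpleGraph V}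

/-! An edge not contained in the centre is determined by its endpoint farther from the centre. This
matches such edges with the non-central vertices, equivariantly, while an edge inside the centre is
fixed by every automorphism. Every automorphism of L(T) comes from T when |V(T)| > 2
(`exists_iso_lineGraph_eq`; a single vertex is treated separately). So D(L(T)) ≤ k exactly when some
k-colouring of V(T) breaks every nontrivial automorphism off the centre
(`exists_lineGraph_distinguishes_iff`). Take k = D(T).

Suppose a colouring breaks, off the centre, all nontrivial automorphisms fixing the centre
pointwise. Then isomorphic branches at one central vertex carry inequivalent distinguishing
colourings, so at most m_i of them are there, with equality iff every such colouring occurs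
(`CenterFixingDistinguishes.ncard_eq_iff`). If equality holds at both ends of a central edge for all
classes, pairing equally coloured branches yields a swap of the ends that preserves colours off the
centre (`not_offCenterDistinguishes`). Otherwise a distinguishing k-colouring of T can fail off the
centre only through such a swap, and recolouring one branch with a colouring missing at its end
destroys all swaps (`exists_offCenterDistinguishes_of_recolour`). -/

/-! ### Distances and the centre of a tree. -/

theorem _root_.SimpleGraph.IsTree.not_triangle (hT : T.IsTree) {a b c : V} (hab : T.Adj a b) (hbc : T.Adj b c)
    (hac : T.Adj a c) : False := by
  have h := hT.dist_ne_of_adj a hbc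
  rw [dist_eq_one_iff_adj.2 hab, dist_eq_one_iff_adj.2 hac] at h
  exact h rfl

/-- A neighbour of `v` closer to `u` is the penultimate vertex of a path from `u` to `v`, and that
path is unique. -/
theorem _root_.SimpleGraph.IsTree.eq_of_dist_lt (hT : T.IsTree) {u v a b : V} (ha : T.Adj v a) (hb : T.Adj v b)
    (hua : T.dist u a < T.dist u v) (hub : T.dist u b < T.dist u v) : a = b := by
  have key : ∀ x, T.Adj v x → T.dist u x < T.dist u v →
      ∃ p : T.Walk u v, p.IsPath ∧ p.penultimate = x := by
    intro x hx hux
    obtain ⟨p, hp⟩ := hT.connected.exists_walk_length_eq_dist u x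
    refine ⟨p.concat hx.symm, ?_, by simp⟩
    apply Walk.isPath_of_length_eq_dist
    rcases hT.dist_eq_dist_add_one_of_adj u hx with h | h
    · simp [hp, h]
    · omega
  obtain ⟨p, hp, rfl⟩ := key a ha hua
  obtain ⟨q, hq, rfl⟩ := key b hb hub
  rw [(hT.existsUnique_path u v).unique hp hq]

theorem _root_.SimpleGraph.IsTree.exists_dist_lt (hT : T.IsTree) {u v : V} (h : v ≠ u) :
    ∃ p, T.Adj v p ∧ T.dist u p < T.dist u v := by
  obtain ⟨p, hp⟩ := hT.connected.exists_walk_length_eq_dist v u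
  cases p with
  | nil => exact absurd rfl h
  | @cons _ x _ hx q =>
    refine ⟨x, hx, ?_⟩
    have := T.dist_le q
    rw [Walk.length_cons] at hp
    rw [T.dist_comm, T.dist_comm (u := u)]
    omega

/-- A path that has started to move away from `v` keeps doing so: a step back towards `v` would have
to return to `x`, which is farther from `y`. -/
theorem _root_.SimpleGraph.IsTree.dist_eq_add_of_turn (hT : T.IsTree) {v y : V} {n : ℕ} {x z : V} (hn : T.dist y z = n)
    (hxz : T.Adj x z) (hv : T.dist v z = T.dist v x + 1) (hy : T.dist y x = T.dist y z + 1) :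
    T.dist v y = T.dist v z + n := by
  induction n generalizing x z with
  | zero =>
    have := hT.connected.dist_eq_zero_iff.1 hn
    subst this
    rfl
  | succ n ih =>
    have hzy : z ≠ y := by
      rintro rfl
      simp at hn
    obtain ⟨z', hz', hlt⟩ := hT.exists_dist_lt hzy
    have h1 : T.dist y z = T.dist y z' + 1 := by
      rcases hT.dist_eq_dist_add_one_of_adj y hz' with h | h <;> omega
    have h2 : T.dist v z' = T.dist v z + 1 := by
      rcases hT.dist_eq_dist_add_one_of_adj v hz' with h | h
      · have : z' = x := hT.eq_of_dist_lt hz' hxz.symm (u := v) (by omega) (by omega)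
        subst this
        omega
      · exact h
    have := ih (by omega) hz' h2 h1
    omega

/-- Otherwise let `z ≠ y` follow `x` on the path to `y`, and let `v` be farthest from `z`. Central
vertices are no farther from `v` than `z` is, so stepping from `x` to `z` moves away from `v`;
continuing to `y` makes `y` too far. -/
theorem _root_.SimpleGraph.IsTree.adj_of_mem_center [Finite V] (hT : T.IsTree) {x y : V} (hx : x ∈ T.center)
    (hy : y ∈ T.center) (hxy : x ≠ y) : T.Adj x y := by
  obtain ⟨z, hxz, hlt⟩ := hT.exists_dist_lt hxy
  by_cases hzy : z = y
  · exact hzy ▸ hxz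
  exfalso
  have : Nonempty V := ⟨x⟩
  obtain ⟨v, hv⟩ := T.exists_edist_eq_eccent_of_finite z
  have key : ∀ c ∈ T.center, T.dist v c ≤ T.dist v z := by
    intro c hc
    have h1 : T.edist c v ≤ T.edist z v := by
      calc T.edist c v ≤ T.eccent c := edist_le_eccent
        _ = T.radius := hc
        _ ≤ T.eccent z := radius_le_eccent
        _ = _ := hv.symm
    rw [← (hT.connected c v).coe_dist_eq_edist, ← (hT.connected z v).coe_dist_eq_edist] at h1
    rw [T.dist_comm, T.dist_comm (u := v)]
    exact_mod_cast h1
  have hyx : T.dist y x = T.dist y z + 1 := by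
    rcases hT.dist_eq_dist_add_one_of_adj y hxz with h | h <;> omega
  have hvz : T.dist v z = T.dist v x + 1 := by
    have := key x hx
    rcases hT.dist_eq_dist_add_one_of_adj v hxz with h | h <;> omega
  have h1 := hT.dist_eq_add_of_turn rfl hxz hvz hyx
  have h2 := key y hy
  have h3 := hT.connected.pos_dist_of_ne (Ne.symm hzy)
  omega

theorem _root_.SimpleGraph.IsTree.exists_center_eq [Finite V] (hT : T.IsTree) :
    ∃ u w, T.center = {u, w} ∧ (u = w ∨ T.Adj u w) := by
  have := hT.connected.nonempty
  obtain ⟨u, hu⟩ := T.center_nonempty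
  by_cases h : ∃ w ∈ T.center, w ≠ u
  · obtain ⟨w, hw, hwu⟩ := h
    have huw := hT.adj_of_mem_center hu hw hwu.symm
    refine ⟨u, w, ?_, Or.inr huw⟩
    ext x
    simp only [Set.mem_insert_iff, Set.mem_singleton_iff]
    constructor
    · intro hx
      by_contra! hne
      exact hT.not_triangle huw (hT.adj_of_mem_center hw hx hne.2.symm)
        (hT.adj_of_mem_center hu hx hne.1.symm)
    · rintro (rfl | rfl) <;> assumption
  · push Not at h
    refine ⟨u, u, ?_, Or.inl rfl⟩
    ext x
    simp only [Set.mem_insert_iff, Set.mem_singleton_iff, or_self]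
    exact ⟨h x, fun h => h ▸ hu⟩

/-! ### Parents: orienting edges towards the centre. -/

/-- `p` is the neighbour of `v` in the direction of the centre. -/
def IsParent (T : SimpleGraph V) (v p : V) : Prop :=
  T.Adj v p ∧ ∀ c ∈ T.center, T.dist c p < T.dist c v

theorem IsParent.notMem_center {v p : V} (h : IsParent T v p) : v ∉ T.center := fun hv => by
  have := h.2 v hv
  simp at this

/-- Approaching one central vertex `c` suffices. For the other one `d`, either `c` is nearer to `v`
and the triangle inequality applies, or the neighbour of `v` towards `d` also approaches `c`, hence
is `p`. -/
theorem IsParent.of_dist_lt [Finite V] (hT : T.IsTree) {v p c : V} (hv : v ∉ T.center)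
    (hc : c ∈ T.center) (hvp : T.Adj v p) (hlt : T.dist c p < T.dist c v) : IsParent T v p := by
  refine ⟨hvp, fun d hd => ?_⟩
  by_cases hcd : c = d
  · exact hcd ▸ hlt
  have hadj := hT.adj_of_mem_center hc hd hcd
  have hdc : T.dist c v + 1 = T.dist d v ∨ T.dist d v + 1 = T.dist c v := by
    have := hT.dist_eq_dist_add_one_of_adj v hadj
    rw [T.dist_comm, T.dist_comm (u := v)] at this
    omega
  have h1 : T.dist d p ≤ T.dist d c + T.dist c p := hT.connected.dist_triangle
  rw [dist_eq_one_iff_adj.2 hadj.symm] at h1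
  rcases hdc with h | h
  · omega
  · have hvd : v ≠ d := fun h => hv (h ▸ hd)
    obtain ⟨q, hvq, hq⟩ := hT.exists_dist_lt hvd
    have h2 : T.dist c q ≤ T.dist c d + T.dist d q := hT.connected.dist_triangle
    rw [dist_eq_one_iff_adj.2 hadj] at h2
    rw [hT.eq_of_dist_lt hvp hvq hlt (by omega)]
    exact hq

theorem _root_.SimpleGraph.IsTree.exists_isParent [Finite V] (hT : T.IsTree) {v : V} (hv : v ∉ T.center) :
    ∃ p, IsParent T v p := by
  have := hT.connected.nonempty
  obtain ⟨u, hu⟩ := T.center_nonempty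
  obtain ⟨p, hp, hlt⟩ := hT.exists_dist_lt (u := u) (v := v) (fun h => hv (h ▸ hu))
  exact ⟨p, .of_dist_lt hT hv hu hp hlt⟩

theorem IsParent.unique [Finite V] (hT : T.IsTree) {v p q : V} (hp : IsParent T v p)
    (hq : IsParent T v q) : p = q := by
  have := hT.connected.nonempty
  obtain ⟨u, hu⟩ := T.center_nonempty
  exact hT.eq_of_dist_lt hp.1 hq.1 (hp.2 u hu) (hq.2 u hu)

theorem IsParent.asymm [Finite V] (hT : T.IsTree) {v p : V} (hp : IsParent T v p) :
    ¬ IsParent T p v := fun h => by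
  have := hT.connected.nonempty
  obtain ⟨u, hu⟩ := T.center_nonempty
  exact lt_asymm (hp.2 u hu) (h.2 u hu)

theorem _root_.SimpleGraph.IsTree.isParent_or [Finite V] (hT : T.IsTree) {a b : V} (hab : T.Adj a b) :
    IsParent T a b ∨ IsParent T b a ∨ (a ∈ T.center ∧ b ∈ T.center) := by
  have := hT.connected.nonempty
  obtain ⟨u, hu⟩ := T.center_nonempty
  by_cases ha : a ∈ T.center
  · by_cases hb : b ∈ T.center
    · exact Or.inr (Or.inr ⟨ha, hb⟩)
    · refine Or.inr (Or.inl (.of_dist_lt hT hb ha hab.symm ?_))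
      simp [dist_eq_one_iff_adj.2 hab]
  · by_cases hb : b ∈ T.center
    · refine Or.inl (.of_dist_lt hT ha hb hab ?_)
      simp [dist_eq_one_iff_adj.2 hab.symm]
    · rcases hT.dist_eq_dist_add_one_of_adj u hab with h | h
      · exact Or.inl (.of_dist_lt hT ha hu hab (by omega))
      · exact Or.inr (Or.inl (.of_dist_lt hT hb hu hab.symm (by omega)))

/-! ### Invariance under automorphisms. -/

theorem edist_map_iso (φ : T ≃g T) (a b : V) : T.edist (φ a) (φ b) = T.edist a b := by
  have key : ∀ (ψ : T ≃g T) a b, T.edist (ψ a) (ψ b) ≤ T.edist a b := by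
    intro ψ a b
    by_cases h : T.edist a b = ⊤
    · rw [h]; exact le_top
    · obtain ⟨p, hp⟩ := T.exists_walk_of_edist_ne_top h
      rw [← hp]
      simpa using T.edist_le (p.map ψ.toHom)
  refine le_antisymm (key φ a b) ?_
  simpa using key φ.symm (φ a) (φ b)

theorem dist_map_iso (φ : T ≃g T) (a b : V) : T.dist (φ a) (φ b) = T.dist a b := by
  rw [SimpleGraph.dist, edist_map_iso, SimpleGraph.dist]

theorem map_mem_center_iff (φ : T ≃g T) {a : V} : φ a ∈ T.center ↔ a ∈ T.center := by
  have : T.eccent (φ a) = T.eccent a := by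
    rw [eccent_def]
    simp only
    rw [← φ.surjective.iSup_comp]
    simp [edist_map_iso]
  rw [mem_center_iff, mem_center_iff, this]

theorem IsParent.map (φ : T ≃g T) {v p : V} (h : IsParent T v p) : IsParent T (φ v) (φ p) := by
  refine ⟨φ.map_adj_iff.2 h.1, fun c hc => ?_⟩
  have := h.2 (φ.symm c) ((map_mem_center_iff φ.symm).2 hc)
  rw [← dist_map_iso φ, ← dist_map_iso φ (φ.symm c) v] at this
  simpa using this

/-! ### Automorphisms of the line graph. -/

theorem lineGraph_meet_iff {e e' : T.edgeSet} :
    (∃ x, x ∈ e.1 ∧ x ∈ e'.1) ↔ e = e' ∨ T.lineGraph.Adj e e' := by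
  rw [lineGraph_adj_iff_exists]
  constructor
  · intro h
    by_cases hee : e = e'
    · exact Or.inl hee
    · exact Or.inr ⟨hee, h⟩
  · rintro (rfl | ⟨-, h⟩)
    · obtain ⟨⟨a, b⟩, he⟩ := e
      exact ⟨a, Sym2.mem_mk_left a b, Sym2.mem_mk_left a b⟩
    · exact h

theorem lineGraph_meet_map_iff (ψ : T.lineGraph ≃g T.lineGraph) {e e' : T.edgeSet} :
    (∃ x, x ∈ (ψ e).1 ∧ x ∈ (ψ e').1) ↔ ∃ x, x ∈ e.1 ∧ x ∈ e'.1 := by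
  rw [lineGraph_meet_iff, lineGraph_meet_iff, ψ.map_adj_iff, ψ.injective.eq_iff]

/-- Three pairwise meeting edges form a triangle or a star, and a tree has no triangle. This lets
incidence at a vertex be read off from the line graph. -/
theorem mem_of_meet_of_meet (hT : T.IsTree) {e e₁ e₂ : T.edgeSet} {v : V} (hne : e₁ ≠ e₂)
    (h₁ : v ∈ e₁.1) (h₂ : v ∈ e₂.1) (m₁ : ∃ x, x ∈ e.1 ∧ x ∈ e₁.1)
    (m₂ : ∃ x, x ∈ e.1 ∧ x ∈ e₂.1) : v ∈ e.1 := by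
  obtain ⟨e, he⟩ := e
  obtain ⟨e₁, he₁⟩ := e₁
  obtain ⟨e₂, he₂⟩ := e₂
  obtain ⟨a, rfl⟩ := Sym2.mem_iff_exists.1 h₁
  obtain ⟨b, rfl⟩ := Sym2.mem_iff_exists.1 h₂
  obtain ⟨x, hx, hxa⟩ := m₁
  obtain ⟨y, hy, hyb⟩ := m₂
  simp only [Sym2.mem_iff] at hxa hyb hx hy ⊢
  rcases hxa with rfl | rfl
  · exact hx
  rcases hyb with rfl | rfl
  · exact hy
  have hxy : x ≠ y := by
    rintro rfl
    exact hne rfl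
  rw [(Sym2.mem_and_mem_iff hxy).1 ⟨hx, hy⟩] at he
  exact (hT.not_triangle he₁ he he₂).elim

/-- `v` and `v'` correspond under `ψ`: the edges at `v` are mapped onto the edges at `v'`. -/
def StarMap (ψ : T.lineGraph ≃g T.lineGraph) (v v' : V) : Prop :=
  ∀ e : T.edgeSet, v ∈ e.1 ↔ v' ∈ (ψ e).1

theorem exists_ne_edge (hT : T.Connected) (h2 : Nat.card V ≠ 2) [Finite V] {a b : V}
    (hab : T.Adj a b) : ∃ c, (T.Adj a c ∧ c ≠ b) ∨ (T.Adj b c ∧ c ≠ a) := by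
  by_contra! h
  apply h2
  have key : ∀ x, T.Reachable a x → x = a ∨ x = b := by
    rintro x ⟨p⟩
    suffices ∀ y (q : T.Walk y x), (y = a ∨ y = b) → (x = a ∨ x = b) from this a p (Or.inl rfl)
    intro y q
    clear p
    induction q with
    | nil => exact id
    | @cons u v w huv q ih =>
      rintro (rfl | rfl)
      · exact ih (Or.inr ((h v).1 huv))
      · exact ih (Or.inl ((h v).2 huv))
  rw [Nat.card_eq_two_iff]
  refine ⟨a, b, hab.ne, ?_⟩
  ext x
  simpa using key x (hT a x)

/-- The image of `v` is the common endpoint of the images of two edges at `v`. -/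
theorem StarMap.exists_of_two {ψ : T.lineGraph ≃g T.lineGraph} (hT : T.IsTree) {v : V}
    {e₁ e₂ : T.edgeSet} (hne : e₁ ≠ e₂) (h₁ : v ∈ e₁.1) (h₂ : v ∈ e₂.1) :
    ∃ v', StarMap ψ v v' := by
  obtain ⟨v', h₁', h₂'⟩ := (lineGraph_meet_map_iff ψ).2 ⟨v, h₁, h₂⟩
  refine ⟨v', fun e => ⟨fun he => ?_, fun he => ?_⟩⟩
  · exact mem_of_meet_of_meet hT (ψ.injective.ne hne) h₁' h₂'
      ((lineGraph_meet_map_iff ψ).2 ⟨v, he, h₁⟩) ((lineGraph_meet_map_iff ψ).2 ⟨v, he, h₂⟩)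
  · exact mem_of_meet_of_meet hT hne h₁ h₂
      ((lineGraph_meet_map_iff ψ).1 ⟨v', he, h₁'⟩) ((lineGraph_meet_map_iff ψ).1 ⟨v', he, h₂'⟩)

theorem StarMap.exists [Finite V] (hT : T.IsTree) (h2 : Nat.card V ≠ 2) [Nontrivial V]
    (ψ : T.lineGraph ≃g T.lineGraph) (v : V) : ∃ v', StarMap ψ v v' := by
  obtain ⟨a, hva⟩ := hT.connected.preconnected.exists_adj_of_nontrivial v
  obtain ⟨c, ⟨hvc, hca⟩ | ⟨hac, hcv⟩⟩ := exists_ne_edge hT.connected h2 hva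
  · refine StarMap.exists_of_two hT (e₁ := ⟨s(v, a), hva⟩) (e₂ := ⟨s(v, c), hvc⟩) ?_
      (Sym2.mem_mk_left _ _) (Sym2.mem_mk_left _ _)
    simpa [Subtype.ext_iff, hvc.ne] using hca.symm
  by_cases hex : ∃ e : T.edgeSet, e ≠ ⟨s(v, a), hva⟩ ∧ v ∈ e.1
  · obtain ⟨e, he, hv⟩ := hex
    exact StarMap.exists_of_two hT he hv (Sym2.mem_mk_left _ _)
  push Not at hex
  -- Here `v` is a leaf, but its neighbour `a` has a second edge and so an image `a'`. The image of
  -- `v` is the other endpoint of the image of the edge `va`.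
  obtain ⟨a', ha'⟩ := StarMap.exists_of_two (ψ := ψ) hT (v := a) (e₁ := ⟨s(v, a), hva⟩)
    (e₂ := ⟨s(a, c), hac⟩) (by simpa [Subtype.ext_iff, hva.ne] using hcv.symm)
    (Sym2.mem_mk_right _ _) (Sym2.mem_mk_left _ _)
  set e : T.edgeSet := ⟨s(v, a), hva⟩ with he
  obtain ⟨v', hv'⟩ := Sym2.mem_iff_exists.1 ((ha' e).1 (Sym2.mem_mk_right _ _))
  have hne : a' ≠ v' := by
    have := (ψ e).2
    rw [hv'] at this
    exact Adj.ne this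
  refine ⟨v', fun e' => ⟨fun h => ?_, fun h => ?_⟩⟩
  · by_cases hee : e' = e
    · rw [hee, hv']
      exact Sym2.mem_mk_right _ _
    · exact absurd h (hex e' hee)
  · by_contra hve
    have hee : e' ≠ e := by
      rintro rfl
      exact hve (Sym2.mem_mk_left _ _)
    -- An edge whose image contains `v'` meets `va`; if not at `v`, then at `a`, so its image has
    -- endpoints `a'` and `v'` and coincides with that of `va`.
    obtain ⟨x, hx, hx'⟩ := (lineGraph_meet_map_iff ψ).1
      ⟨v', h, show v' ∈ (ψ e).1 by rw [hv']; exact Sym2.mem_mk_right _ _⟩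
    have hxa : x = a := by
      rcases Sym2.mem_iff.1 hx' with rfl | rfl
      · exact absurd hx hve
      · rfl
    subst hxa
    apply hee
    apply ψ.injective
    apply Subtype.ext
    rw [(Sym2.mem_and_mem_iff hne).1 ⟨(ha' e').1 hx, h⟩, hv']

/-- Distinct vertices with the same edges would be each other's only neighbours, making the tree a
single edge. -/
theorem eq_of_forall_mem_edge_iff [Finite V] (hT : T.IsTree) (h2 : Nat.card V ≠ 2) [Nontrivial V]
    {v w : V} (h : ∀ e : T.edgeSet, v ∈ e.1 ↔ w ∈ e.1) : v = w := by
  by_contra hne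
  have key : ∀ {v w : V}, v ≠ w → (∀ e : T.edgeSet, v ∈ e.1 → w ∈ e.1) →
      ∀ x, T.Adj v x → x = w := by
    intro v w hne h x hx
    have := h ⟨s(v, x), hx⟩ (Sym2.mem_mk_left _ _)
    rcases Sym2.mem_iff.1 this with h | h
    · exact absurd h.symm hne
    · exact h.symm
  have hv := key hne fun e => (h e).1
  have hw := key (Ne.symm hne) fun e => (h e).2
  obtain ⟨a, hva⟩ := hT.connected.preconnected.exists_adj_of_nontrivial v
  obtain rfl := hv a hva
  obtain ⟨c, ⟨h1, h3⟩ | ⟨h1, h3⟩⟩ := exists_ne_edge hT.connected h2 hva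
  · exact h3 (hv c h1)
  · exact h3 (hw c h1)

theorem StarMap.symm {ψ : T.lineGraph ≃g T.lineGraph} {v v' : V} (h : StarMap ψ v v') :
    StarMap ψ.symm v' v := fun e => by
  rw [h (ψ.symm e), RelIso.apply_symm_apply]

theorem StarMap.unique [Finite V] (hT : T.IsTree) (h2 : Nat.card V ≠ 2) [Nontrivial V]
    {ψ : T.lineGraph ≃g T.lineGraph} {v v' v'' : V} (h' : StarMap ψ v v') (h'' : StarMap ψ v v'') :
    v' = v'' :=
  eq_of_forall_mem_edge_iff hT h2 fun e => by rw [h'.symm e, h''.symm e]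

/-- Every automorphism of the line graph of a tree other than an edge comes from an automorphism
of the tree. -/
theorem exists_iso_lineGraph_eq [Finite V] (hT : T.IsTree) (h2 : Nat.card V ≠ 2) [Nontrivial V]
    (ψ : T.lineGraph ≃g T.lineGraph) : ∃ φ : T ≃g T, φ.lineGraph = ψ := by
  choose φ hφ using StarMap.exists hT h2 ψ
  choose φ' hφ' using StarMap.exists hT h2 ψ.symm
  have hl : Function.LeftInverse φ' φ := fun v =>
    StarMap.unique hT h2 (hφ' (φ v)) (hφ v).symm
  have hr : Function.RightInverse φ' φ := fun v =>
    StarMap.unique hT h2 (hφ (φ' v)) (hφ' v).symm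
  have edge : ∀ {a b : V} (h : T.Adj a b), (ψ ⟨s(a, b), h⟩).1 = s(φ a, φ b) := fun {a b} h =>
    (Sym2.mem_and_mem_iff (hl.injective.ne h.ne)).1
      ⟨(hφ a _).1 (Sym2.mem_mk_left _ _), (hφ b _).1 (Sym2.mem_mk_right _ _)⟩
  refine ⟨⟨⟨φ, φ', hl, hr⟩, fun {a b} => ⟨fun h => ?_, fun h => ?_⟩⟩, ?_⟩
  · have hab : a ≠ b := by
      rintro rfl
      exact h.ne rfl
    have ha := (hφ a (ψ.symm ⟨s(φ a, φ b), h⟩)).2 (by simp)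
    have hb := (hφ b (ψ.symm ⟨s(φ a, φ b), h⟩)).2 (by simp)
    have he := (ψ.symm ⟨s(φ a, φ b), h⟩).2
    rwa [(Sym2.mem_and_mem_iff hab).1 ⟨ha, hb⟩] at he
  · have he := (ψ ⟨s(a, b), h⟩).2
    rwa [edge h] at he
  · ext e
    obtain ⟨⟨a, b⟩, h⟩ := e
    rw [show (ψ ⟨Quot.mk _ (a, b), h⟩).1 = s(φ a, φ b) from edge h]
    rfl

theorem lineGraph_ne_one [Finite V] (hT : T.IsTree) (h2 : Nat.card V ≠ 2) [Nontrivial V]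
    {φ : T ≃g T} (hφ : φ ≠ 1) : (φ.lineGraph : T.lineGraph ≃g T.lineGraph) ≠ 1 := by
  intro h
  apply hφ
  ext v
  refine eq_of_forall_mem_edge_iff hT h2 fun e => ?_
  have he : e.1.map φ = e.1 := congrArg Subtype.val (DFunLike.congr_fun h e)
  have : φ v ∈ e.1.map φ ↔ v ∈ e.1 := by
    rw [Sym2.mem_map]
    constructor
    · rintro ⟨a, ha, hav⟩
      exact φ.injective hav ▸ ha
    · exact fun h => ⟨v, h, rfl⟩
  rw [he] at this
  exact this

/-! ### From edge colourings to colourings off the centre. -/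

/-- Every nontrivial automorphism changes the colour of a vertex outside the centre. -/
def OffCenterDistinguishes (T : SimpleGraph V) {α : Type*} (f : V → α) : Prop :=
  ∀ φ : T ≃g T, φ ≠ 1 → ∃ v, v ∉ T.center ∧ f v ≠ f (φ v)

/-- Colours are transferred between a non-central vertex and the edge to its parent, a
correspondence that commutes with automorphisms. -/
theorem exists_lineGraph_distinguishes_iff [Finite V] (hT : T.IsTree) (h2 : Nat.card V ≠ 2)
    [Nontrivial V] {α : Type*} :
    (∃ g : T.edgeSet → α, Distinguishes T.lineGraph g) ↔
      ∃ f : V → α, OffCenterDistinguishes T f := by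
  classical
  have huniq : ∀ {v p a b : V}, IsParent T v p → IsParent T a b → s(v, p) = s(a, b) →
      v = a := by
    intro v p a b h h' he
    rcases Sym2.eq_iff.1 he with ⟨rfl, rfl⟩ | ⟨rfl, rfl⟩
    · rfl
    · exact (h.asymm hT h').elim
  constructor
  · rintro ⟨g, hg⟩
    obtain ⟨a, b, hab⟩ := (inferInstance : Nontrivial V).exists_pair_ne
    obtain ⟨c, hac⟩ := hT.connected.preconnected.exists_adj_of_nontrivial a
    have : Nonempty α := ⟨g ⟨s(a, c), hac⟩⟩
    have hf : ∀ v, ∃ x : α, ∀ p (h : IsParent T v p), x = g ⟨s(v, p), h.1⟩ := by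
      intro v
      by_cases hv : v ∈ T.center
      · exact ⟨Classical.arbitrary α, fun p h => (h.notMem_center hv).elim⟩
      · obtain ⟨p, hp⟩ := hT.exists_isParent hv
        refine ⟨g ⟨s(v, p), hp.1⟩, fun q hq => ?_⟩
        obtain rfl := hp.unique hT hq
        rfl
    choose f hf using hf
    refine ⟨f, fun φ hφ => ?_⟩
    obtain ⟨⟨⟨a, b⟩, h⟩, hne⟩ := hg _ (lineGraph_ne_one hT h2 hφ)
    replace h : T.Adj a b := h
    replace hne : g ⟨s(a, b), h⟩ ≠ g ⟨s(φ a, φ b), φ.map_adj_iff.2 h⟩ := hne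
    have hmain : ∀ {a b : V} (h : IsParent T a b),
        g ⟨s(a, b), h.1⟩ ≠ g ⟨s(φ a, φ b), φ.map_adj_iff.2 h.1⟩ →
        ∃ v, v ∉ T.center ∧ f v ≠ f (φ v) := by
      intro a b hab hne
      refine ⟨a, hab.notMem_center, ?_⟩
      rwa [hf a b hab, hf (φ a) (φ b) (hab.map φ)]
    rcases hT.isParent_or h with hab | hba | ⟨ha, hb⟩
    · exact hmain hab hne
    · refine hmain hba ?_
      simpa only [Sym2.eq_swap] using hne
    -- An edge inside the centre is mapped to itself, so its colour cannot have changed.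
    · exfalso
      apply hne
      congr 2
      obtain ⟨u, w, hC, -⟩ := hT.exists_center_eq
      have ha' := (map_mem_center_iff φ).2 ha
      have hb' := (map_mem_center_iff φ).2 hb
      have hab := h.ne
      have hab' := φ.injective.ne h.ne
      simp only [hC, Set.mem_insert_iff, Set.mem_singleton_iff] at ha hb ha' hb'
      rw [Sym2.eq_iff]
      grind
  · rintro ⟨f, hf⟩
    have hg : ∀ e : T.edgeSet, ∃ x : α, ∀ v p, IsParent T v p → e.1 = s(v, p) → x = f v := by
      intro e
      by_cases h : ∃ v p, IsParent T v p ∧ e.1 = s(v, p)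
      · obtain ⟨v, p, h, he⟩ := h
        exact ⟨f v, fun a b hab he' => by rw [huniq h hab (he.symm.trans he')]⟩
      · push Not at h
        -- An edge inside the centre may get any colour: only parent edges are consulted below.
        obtain ⟨a, b, hab⟩ := (inferInstance : Nontrivial V).exists_pair_ne
        exact ⟨f a, fun v p hv he => (h v p hv he).elim⟩
    choose g hg using hg
    refine ⟨g, fun ψ hψ => ?_⟩
    obtain ⟨φ, rfl⟩ := exists_iso_lineGraph_eq hT h2 ψ
    have hφ : φ ≠ 1 := by
      rintro rfl
      apply hψ
      ext ⟨⟨a, b⟩, h⟩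
      rfl
    obtain ⟨v, hv, hne⟩ := hf φ hφ
    obtain ⟨p, hp⟩ := hT.exists_isParent hv
    refine ⟨⟨s(v, p), hp.1⟩, ?_⟩
    rwa [hg _ v p hp rfl, hg _ (φ v) (φ p) (hp.map φ) rfl]

/-! ### Branches and gluing of automorphisms. -/

/-- Two distinct such vertices would be joined both by a path avoiding the centre and by one through
it. -/
theorem eq_of_reachable_of_adj_center [Finite V] (hT : T.IsTree) {a b : ↥(T.centerᶜ)} {c c' : V}
    (h : (T.induce T.centerᶜ).Reachable a b) (hc : c ∈ T.center) (hc' : c' ∈ T.center)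
    (hac : T.Adj a c) (hbc : T.Adj b c') : a = b := by
  classical
  by_contra hne
  obtain ⟨p, hp⟩ := h.exists_isPath
  let ι : T.induce T.centerᶜ →g T := (Embedding.induce T.centerᶜ).toHom
  have hP : (p.map ι).IsPath := Walk.IsPath.map Subtype.val_injective hp
  have hne' : a.1 ≠ b.1 := fun h => hne (Subtype.ext h)
  have hcP : c ∉ (p.map ι).support := by
    rw [Walk.support_map, List.mem_map]
    rintro ⟨x, -, hx⟩
    exact x.2 (show x.1 ∈ T.center from (show x.1 = c from hx) ▸ hc)
  have hac' : a.1 ≠ c' := fun h => a.2 (h ▸ hc')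
  have hbc' : b.1 ≠ c := fun h => b.2 (h ▸ hc)
  by_cases hcc : c = c'
  · subst hcc
    let q : T.Walk a.1 b.1 := .cons hac (.cons hbc.symm .nil)
    have hq : q.IsPath := by
      simp [q, Walk.cons_isPath_iff, hac.ne, hne', hbc'.symm]
    rw [(hT.existsUnique_path a.1 b.1).unique hP hq] at hcP
    exact hcP (List.mem_cons_of_mem _ (Walk.start_mem_support _))
  · let q : T.Walk a.1 b.1 := .cons hac (.cons (hT.adj_of_mem_center hc hc' hcc)
      (.cons hbc.symm .nil))
    have hq : q.IsPath := by
      simp [q, Walk.cons_isPath_iff, hac.ne, hne', hbc'.symm, hcc, hac', hbc.ne.symm]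
    rw [(hT.existsUnique_path a.1 b.1).unique hP hq] at hcP
    exact hcP (List.mem_cons_of_mem _ (Walk.start_mem_support _))

theorem adj_center_unique [Finite V] (hT : T.IsTree) {v c c' : V} (hc : c ∈ T.center)
    (hc' : c' ∈ T.center) (h : T.Adj v c) (h' : T.Adj v c') : c = c' := by
  by_contra hne
  exact hT.not_triangle h (hT.adj_of_mem_center hc hc' hne) h'

namespace Branch

/-- `v` is a vertex of the branch `S`. -/
def Mem (S : Branch T) (v : V) : Prop := ∃ x : S.comp.supp, x.1.1 = v

theorem mem_coe (S : Branch T) (x : S.comp.supp) : S.Mem x.1.1 := ⟨x, rfl⟩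

theorem mem_of_adj {S : Branch T} {v w : V} (h : S.Mem v) (hvw : T.Adj v w) (hw : w ∉ T.center) :
    S.Mem w := by
  obtain ⟨x, rfl⟩ := h
  refine ⟨⟨⟨w, hw⟩, ?_⟩, rfl⟩
  have hx := x.2
  rw [ConnectedComponent.mem_supp_iff] at hx ⊢
  rw [← hx]
  exact ConnectedComponent.sound (Adj.reachable (show T.Adj w x.1.1 from hvw.symm))

theorem eq_root [Finite V] (hT : T.IsTree) {S : Branch T} (x : S.comp.supp) {c : V}
    (hc : c ∈ T.center) (h : T.Adj x.1.1 c) : x = S.root := by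
  obtain ⟨d, hd, hr⟩ := S.adj_center
  refine Subtype.ext (eq_of_reachable_of_adj_center hT ?_ hc hd h hr)
  apply ConnectedComponent.exact
  exact x.2.trans S.root.2.symm

theorem eq_of_mem [Finite V] (hT : T.IsTree) {S S' : Branch T} {v : V} (h : S.Mem v)
    (h' : S'.Mem v) : S = S' := by
  obtain ⟨x, rfl⟩ := h
  obtain ⟨x', hx⟩ := h'
  have hxx : x'.1 = x.1 := Subtype.ext hx
  have hc : S.comp = S'.comp := by
    rw [← (ConnectedComponent.mem_supp_iff _ _).1 x.2,
      ← (ConnectedComponent.mem_supp_iff _ _).1 x'.2, hxx]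
  obtain ⟨c, r, hr⟩ := S
  obtain ⟨c', r', hr'⟩ := S'
  dsimp only at hc
  subst hc
  obtain ⟨d, hd, hrd⟩ := hr
  obtain rfl := eq_root hT (S := ⟨c, r', hr'⟩) r hd hrd
  rfl

theorem exists_mem [Finite V] (hT : T.IsTree) {v : V} (hv : v ∉ T.center) :
    ∃ S : Branch T, S.Mem v := by
  have := hT.connected.nonempty
  obtain ⟨u, hu⟩ := T.center_nonempty
  induction h : T.dist u v using Nat.strong_induction_on generalizing v with
  | _ n ih =>
    obtain ⟨p, hp⟩ := hT.exists_isParent hv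
    by_cases hpc : p ∈ T.center
    · exact ⟨⟨(T.induce T.centerᶜ).connectedComponentMk ⟨v, hv⟩, ⟨⟨v, hv⟩, rfl⟩, p, hpc, hp.1⟩,
        ⟨⟨v, hv⟩, rfl⟩, rfl⟩
    · obtain ⟨S, hS⟩ := ih _ (h ▸ hp.2 u hu) hpc rfl
      exact ⟨S, mem_of_adj hS hp.1.symm hv⟩

/-- The automorphism of `T - C(T)` induced by an automorphism of `T`. -/
def complIso (φ : T ≃g T) : T.induce T.centerᶜ ≃g T.induce T.centerᶜ where
  toFun x := ⟨φ x.1, fun h => x.2 ((map_mem_center_iff φ).1 h)⟩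
  invFun x := ⟨φ.symm x.1, fun h => x.2 ((map_mem_center_iff φ.symm).1 h)⟩
  left_inv _ := Subtype.ext (φ.symm_apply_apply _)
  right_inv _ := Subtype.ext (φ.apply_symm_apply _)
  map_rel_iff' := φ.map_adj_iff

/-- The image of a branch under an automorphism of the tree. -/
def map (φ : T ≃g T) (S : Branch T) : Branch T where
  comp := (complIso φ).connectedComponentEquiv S.comp
  root := ConnectedComponent.isoEquivSupp (complIso φ) S.comp S.root
  adj_center := by
    obtain ⟨c, hc, h⟩ := S.adj_center
    exact ⟨φ c, (map_mem_center_iff φ).2 hc, φ.map_adj_iff.2 h⟩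

/-- The isomorphism between a branch and its image. -/
def mapIso (φ : T ≃g T) (S : Branch T) : S.graph ≃g (S.map φ).graph where
  toEquiv := ConnectedComponent.isoEquivSupp (complIso φ) S.comp
  map_rel_iff' := φ.map_adj_iff

theorem mapIso_coe (φ : T ≃g T) (S : Branch T) (x : S.comp.supp) :
    (mapIso φ S x).1.1 = φ x.1.1 := rfl

theorem mapIso_root (φ : T ≃g T) (S : Branch T) : mapIso φ S S.root = (S.map φ).root := rfl

instance [Finite V] : Finite (Branch T) := by
  refine Finite.of_injective (fun S : Branch T => (⟨S.comp, S.root.1⟩ : _ × _)) ?_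
  rintro ⟨c, r, h⟩ ⟨c', r', h'⟩ he
  simp only [Prod.mk.injEq] at he
  obtain ⟨rfl, he⟩ := he
  obtain rfl := Subtype.ext he
  rfl

end Branch

/-- On a finite set the inverse of a permutation is one of its powers, so it preserves adjacency
too. -/
theorem isIso_of_injective [Finite V] (φ : V → V) (hφ : Function.Injective φ)
    (h : ∀ a b, T.Adj a b → T.Adj (φ a) (φ b)) : ∃ ψ : T ≃g T, ∀ v, ψ v = φ v := by
  let e : Equiv.Perm V := Equiv.ofBijective φ (Finite.injective_iff_bijective.1 hφ)
  have hpow : ∀ n : ℕ, ∀ a b, T.Adj a b → T.Adj ((e ^ n) a) ((e ^ n) b) := by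
    intro n
    induction n with
    | zero => simp
    | succ n ih =>
      intro a b hab
      rw [pow_succ']
      exact h _ _ (ih a b hab)
  refine ⟨⟨e, fun {a b} => ⟨fun hab => ?_, h a b⟩⟩, fun v => rfl⟩
  have he : e ^ (orderOf e - 1) * e = 1 := by
    rw [← pow_succ, Nat.sub_add_cancel (isOfFinOrder_of_finite e).orderOf_pos, pow_orderOf_eq_one]
  have := hpow (orderOf e - 1) _ _ hab
  rwa [← Equiv.Perm.mul_apply, ← Equiv.Perm.mul_apply, he] at this

/-- An automorphism of the centre and a family of isomorphisms between branches compatible with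
it glue to an automorphism of the tree. -/
theorem exists_iso_glue [Finite V] (hT : T.IsTree) (π : V → V)
    (hπ : ∀ c ∈ T.center, π c ∈ T.center) (hinj : Set.InjOn π T.center)
    (σ : Branch T → Branch T) (hσ : Function.Injective σ)
    (hat : ∀ c ∈ T.center, ∀ S ∈ branchesAt T c, σ S ∈ branchesAt T (π c))
    (β : ∀ S : Branch T, S.graph ≃g (σ S).graph) (hβ : ∀ S, β S S.root = (σ S).root) :
    ∃ φ : T ≃g T, (∀ c ∈ T.center, φ c = π c) ∧
      ∀ (S : Branch T) (x : S.comp.supp), φ x.1.1 = (β S x).1.1 := by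
  classical
  have hex : ∀ v : V, ∃ v', (v ∈ T.center → v' = π v) ∧
      ∀ (S : Branch T) (x : S.comp.supp), x.1.1 = v → v' = (β S x).1.1 := by
    intro v
    by_cases hv : v ∈ T.center
    · refine ⟨π v, fun _ => rfl, fun S x hx => ?_⟩
      exact (x.1.2 (hx ▸ hv)).elim
    · obtain ⟨S, x, rfl⟩ := Branch.exists_mem hT hv
      refine ⟨(β S x).1.1, fun h => (hv h).elim, fun S' x' hx => ?_⟩
      obtain rfl := Branch.eq_of_mem hT (S.mem_coe x) ⟨x', hx⟩
      have : x' = x := Subtype.ext (Subtype.ext hx)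
      rw [this]
  choose φ hφ using hex
  have hC : ∀ c ∈ T.center, φ c = π c := fun c => (hφ c).1
  have hB : ∀ (S : Branch T) (x : S.comp.supp), φ x.1.1 = (β S x).1.1 := fun S x =>
    (hφ x.1.1).2 S x rfl
  have hcenter : ∀ v, φ v ∈ T.center ↔ v ∈ T.center := by
    intro v
    by_cases hv : v ∈ T.center
    · simp [hv, hC v hv, hπ v hv]
    · obtain ⟨S, x, rfl⟩ := Branch.exists_mem hT hv
      rw [hB]
      exact iff_of_false (β S x).1.2 hv
  -- An edge between the centre and a branch ends at the root; this is the only place where `hat`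
  -- and `hβ` are needed.
  have hroot : ∀ a b, a ∈ T.center → b ∉ T.center → T.Adj b a → T.Adj (φ b) (φ a) := by
    intro a b ha hb hab
    obtain ⟨S, x, rfl⟩ := Branch.exists_mem hT hb
    obtain rfl := Branch.eq_root hT x ha hab
    rw [hB, hβ, hC a ha]
    exact hat a ha S hab
  have hφinj : Function.Injective φ := by
    intro a b hab
    by_cases ha : a ∈ T.center
    · have hb : b ∈ T.center := by rwa [← hcenter, ← hab, hcenter]
      rw [hC a ha, hC b hb] at hab
      exact hinj ha hb hab
    · have hb : b ∉ T.center := by rwa [← hcenter, ← hab, hcenter]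
      obtain ⟨S, x, rfl⟩ := Branch.exists_mem hT ha
      obtain ⟨S', x', rfl⟩ := Branch.exists_mem hT hb
      rw [hB, hB] at hab
      obtain rfl := hσ (Branch.eq_of_mem hT ((σ S).mem_coe _) ⟨_, hab.symm⟩)
      rw [(β S).injective (Subtype.ext (Subtype.ext hab))]
  have hφadj : ∀ a b, T.Adj a b → T.Adj (φ a) (φ b) := by
    intro a b hab
    by_cases ha : a ∈ T.center
    · by_cases hb : b ∈ T.center
      · rw [hC a ha, hC b hb]
        exact hT.adj_of_mem_center (hπ a ha) (hπ b hb) (hinj.ne ha hb hab.ne)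
      · exact (hroot a b ha hb hab.symm).symm
    · by_cases hb : b ∈ T.center
      · exact hroot b a hb ha hab
      · obtain ⟨S, x, rfl⟩ := Branch.exists_mem hT ha
        obtain ⟨x', rfl⟩ := Branch.mem_of_adj (S.mem_coe x) hab hb
        rw [hB, hB]
        exact (β S).map_adj_iff.2 hab
  obtain ⟨ψ, hψ⟩ := isIso_of_injective φ hφinj hφadj
  exact ⟨ψ, fun c hc => by rw [hψ, hC c hc], fun S x => by rw [hψ, hB]⟩

end TreeDist

/-! ### Colourings restricted to branches. -/

namespace TreeDist

open SimpleGraph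

variable {V : Type*} {T : SimpleGraph V} {α : Type*}

/-- Every nontrivial automorphism fixing the centre pointwise changes the colour of a vertex
outside the centre. -/
def CenterFixingDistinguishes (T : SimpleGraph V) (f : V → α) : Prop :=
  ∀ φ : T ≃g T, φ ≠ 1 → (∀ c ∈ T.center, φ c = c) → ∃ v, v ∉ T.center ∧ f v ≠ f (φ v)

theorem OffCenterDistinguishes.centerFixing {f : V → α} (hf : OffCenterDistinguishes T f) :
    CenterFixingDistinguishes T f := fun φ hφ _ => hf φ hφ

theorem Distinguishes.centerFixing {f : V → α} (hf : Distinguishes T f) :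
    CenterFixingDistinguishes T f := fun φ hφ hC => by
  obtain ⟨v, hv⟩ := hf φ hφ
  exact ⟨v, fun h => hv (by rw [hC v h]), hv⟩

theorem RootedDistinguishes.comp_iso {W : Type*} {G : SimpleGraph V} {G' : SimpleGraph W} {r : V}
    {r' : W} {h : V → α} (hh : RootedDistinguishes G r h) (β : G' ≃g G) (hβ : β r' = r) :
    RootedDistinguishes G' r' (h ∘ β) := by
  intro φ hφr hφ
  obtain ⟨v, hv⟩ := hh ((β.symm.trans φ).trans β) (by simp [← hβ, hφr]) (by
    intro h1
    apply hφ
    ext v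
    have := DFunLike.congr_fun h1 (β v)
    simpa using this)
  exact ⟨β.symm v, by simpa using hv⟩

namespace Branch

/-- The restriction of a colouring to a branch. -/
def restrict (S : Branch T) (f : V → α) : S.comp.supp → α := fun x => f x.1.1

/-- Some rooted isomorphism carries the colouring `h` of `S` to the restriction of `f` to `X`. -/
def ColourIso (S X : Branch T) (h : S.comp.supp → α) (f : V → α) : Prop :=
  ∃ β : S.graph ≃g X.graph, β S.root = X.root ∧ ∀ x, h x = f (β x).1.1

theorem exists_iso_of_map_eq {φ : T ≃g T} {S X : Branch T} (h : S.map φ = X) :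
    ∃ β : S.graph ≃g X.graph, β S.root = X.root ∧ ∀ x, (β x).1.1 = φ x.1.1 := by
  subst h
  exact ⟨mapIso φ S, mapIso_root φ S, mapIso_coe φ S⟩

theorem map_mem_branchesAt {S : Branch T} {c : V} (φ : T ≃g T) (h : S ∈ branchesAt T c) :
    S.map φ ∈ branchesAt T (φ c) :=
  φ.map_adj_iff.2 h

theorem eq_of_mem_branchesAt [Finite V] (hT : T.IsTree) {S : Branch T} {c c' : V}
    (hc : c ∈ T.center) (hc' : c' ∈ T.center) (h : S ∈ branchesAt T c)
    (h' : S ∈ branchesAt T c') : c = c' :=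
  adj_center_unique hT hc hc' h h'

end Branch

open Branch

/-- A colour-preserving rooted automorphism of one branch extends by the identity to the whole tree.
-/
theorem CenterFixingDistinguishes.restrict [Finite V] (hT : T.IsTree) {f : V → α}
    (hf : CenterFixingDistinguishes T f) (S : Branch T) :
    RootedDistinguishes S.graph S.root (S.restrict f) := by
  classical
  intro β hβ hne
  by_contra! hcol
  obtain ⟨φ, hφC, hφ⟩ := exists_iso_glue hT id (fun c hc => hc) (Set.injOn_id _) id
    Function.injective_id (fun _ _ _ h => h)
    (Function.update (fun X : Branch T => (RelIso.refl _ : X.graph ≃g X.graph)) S β) (by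
      intro X
      by_cases hX : X = S
      · subst hX
        simpa using hβ
      · simp [hX])
  obtain ⟨v, hv, hfv⟩ := hf φ (by
    rintro rfl
    apply hne
    ext x
    have := hφ S x
    simp only [Function.update_self] at this
    exact this.symm) hφC
  obtain ⟨X, x, rfl⟩ := Branch.exists_mem hT hv
  apply hfv
  rw [hφ]
  by_cases hX : X = S
  · subst hX
    simpa [Branch.restrict] using hcol x
  · simp [hX]

/-- Otherwise exchanging the two branches along the isomorphism is a nontrivial automorphism fixing
the centre and all colours off it. -/
theorem CenterFixingDistinguishes.eq_of_colourIso [Finite V] (hT : T.IsTree) {f : V → α}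
    (hf : CenterFixingDistinguishes T f) {c : V} (hc : c ∈ T.center) {S S' : Branch T}
    (hS : S ∈ branchesAt T c) (hS' : S' ∈ branchesAt T c)
    (h : ColourIso S S' (S.restrict f) f) : S = S' := by
  classical
  by_contra hne
  obtain ⟨β, hβ, hcol⟩ := h
  have hex : ∀ X : Branch T, ∃ γ : X.graph ≃g (Equiv.swap S S' X).graph,
      γ X.root = (Equiv.swap S S' X).root ∧ ∀ x : X.comp.supp, f x.1.1 = f (γ x).1.1 := by
    intro X
    generalize hY : Equiv.swap S S' X = Y
    by_cases hX : X = S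
    · subst hX
      rw [Equiv.swap_apply_left] at hY
      subst hY
      exact ⟨β, hβ, hcol⟩
    by_cases hX' : X = S'
    · subst hX'
      rw [Equiv.swap_apply_right] at hY
      subst hY
      refine ⟨β.symm, by rw [← hβ, RelIso.symm_apply_apply], fun x => ?_⟩
      have := hcol (β.symm x)
      rw [RelIso.apply_symm_apply] at this
      exact this.symm
    · rw [Equiv.swap_apply_of_ne_of_ne hX hX'] at hY
      subst hY
      exact ⟨RelIso.refl _, rfl, fun _ => rfl⟩
  choose γ hγ hγf using hex
  obtain ⟨φ, hφC, hφ⟩ := exists_iso_glue hT id (fun c hc => hc) (Set.injOn_id _)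
    (Equiv.swap S S') (Equiv.injective _) (by
      intro d hd X hX
      rw [id]
      by_cases hXS : X = S
      · subst hXS
        rw [Equiv.swap_apply_left, eq_of_mem_branchesAt hT hd hc hX hS]
        exact hS'
      by_cases hXS' : X = S'
      · subst hXS'
        rw [Equiv.swap_apply_right, eq_of_mem_branchesAt hT hd hc hX hS']
        exact hS
      · rwa [Equiv.swap_apply_of_ne_of_ne hXS hXS']) γ hγ
  obtain ⟨v, hv, hfv⟩ := hf φ (by
    rintro rfl
    have h1 := hφ S S.root
    rw [hγ, Equiv.swap_apply_left] at h1
    exact hne (Branch.eq_of_mem hT ⟨S.root, h1⟩ (S'.mem_coe S'.root))) hφC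
  obtain ⟨X, x, rfl⟩ := Branch.exists_mem hT hv
  exact hfv (by rw [hφ, hγf])

/-- The number of branches at `c` equivalent to `S` is the number of colourings of `S` if and only
if all of these colourings occur at `c`. -/
theorem CenterFixingDistinguishes.ncard_eq_iff [Finite V] (hT : T.IsTree) {k : ℕ} {f : V → Fin k}
    (hf : CenterFixingDistinguishes T f) {c : V} (hc : c ∈ T.center) (S : Branch T) :
    ({X | branchSetoid T X S} ∩ branchesAt T c).ncard = rootedCount S.graph S.root k ↔
      ∀ h : S.comp.supp → Fin k, RootedDistinguishes S.graph S.root h →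
        ∃ X ∈ branchesAt T c, ColourIso S X h f := by
  have hex : ∀ X : ↥({X | branchSetoid T X S} ∩ branchesAt T c),
      ∃ β : S.graph ≃g X.1.graph, β S.root = X.1.root := by
    rintro ⟨X, hX, -⟩
    exact (branchSetoid T).symm hX
  choose β hβ using hex
  -- `F` records the colouring of each branch, transported to `S`. It is injective by
  -- `eq_of_colourIso`, so equality of cardinalities amounts to surjectivity.
  let F : ↥({X | branchSetoid T X S} ∩ branchesAt T c) →
      Quotient (rootedColouringSetoid S.graph S.root k) := fun X =>
    Quotient.mk _ ⟨X.1.restrict f ∘ β X, (hf.restrict hT X.1).comp_iso (β X) (hβ X)⟩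
  have hF : ∀ h X, Quotient.mk _ h = F X ↔ ColourIso S X.1 h.1 f := by
    intro h X
    rw [Quotient.eq]
    constructor
    · rintro ⟨φ, hφ, hcol⟩
      exact ⟨φ.trans (β X), by simp [hφ, hβ], hcol⟩
    · rintro ⟨γ, hγ, hcol⟩
      refine ⟨γ.trans (β X).symm, ?_, fun v => ?_⟩
      · simp [hγ, ← hβ]
      · simp [hcol, Branch.restrict]
  have hinj : Function.Injective F := by
    intro X Y hXY
    obtain ⟨γ, hγ, hcol⟩ := (hF _ _).1 hXY
    refine Subtype.ext (hf.eq_of_colourIso hT hc X.2.2 Y.2.2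
      ⟨(β X).symm.trans γ, by simp [← hβ X, hγ], fun x => ?_⟩)
    have := hcol ((β X).symm x)
    simpa using this
  have hsurj : Function.Surjective F ↔
      ({X | branchSetoid T X S} ∩ branchesAt T c).ncard = rootedCount S.graph S.root k := by
    rw [rootedCount, ← Nat.card_coe_set_eq]
    constructor
    · exact fun h => Nat.card_eq_of_bijective F ⟨hinj, h⟩
    · intro h
      exact (hinj.bijective_of_nat_card_le h.ge).2
  rw [← hsurj]
  constructor
  · intro hs h hh
    obtain ⟨X, hX⟩ := hs (Quotient.mk _ ⟨h, hh⟩)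
    exact ⟨X.1, X.2.2, (hF _ _).1 hX.symm⟩
  · intro hs q
    induction q using Quotient.inductionOn with
    | _ h =>
      obtain ⟨X, hX, γ, hγ, hcol⟩ := hs h.1 h.2
      exact ⟨⟨X, (branchSetoid T).symm ⟨γ, hγ⟩, hX⟩, ((hF _ _).2 ⟨γ, hγ, hcol⟩).symm⟩

end TreeDist

/-! ### Swapping the two ends of the centre, and recolouring. -/

namespace TreeDist

open SimpleGraph Branch

variable {V : Type*} {T : SimpleGraph V}

/-- Every colouring occurs at both ends, so each branch has an equally coloured partner at the other
end; gluing these pairings gives a swap unseen off the centre. -/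
theorem not_offCenterDistinguishes [Finite V] (hT : T.IsTree) {k : ℕ} {u w : V} (huw : T.Adj u w)
    (hC : T.center = {u, w})
    (hn : ∀ c ∈ T.center, ∀ S : Branch T, ({X | branchSetoid T X S} ∩ branchesAt T c).ncard =
      rootedCount S.graph S.root k) (f : V → Fin k) : ¬ OffCenterDistinguishes T f := by
  classical
  intro hf
  have hfix := hf.centerFixing
  have hu : u ∈ T.center := by simp [hC]
  have hw : w ∈ T.center := by simp [hC]
  let π := Equiv.swap u w
  have hπ : ∀ c ∈ T.center, π c ∈ T.center := by
    intro c hc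
    rw [hC] at hc
    rcases hc with rfl | rfl
    · simpa [π] using hw
    · simpa [π] using hu
  have hex : ∀ S : Branch T, ∃ S' : Branch T, (∃ c ∈ T.center, S ∈ branchesAt T c ∧
      S' ∈ branchesAt T (π c)) ∧ ColourIso S S' (S.restrict f) f := by
    intro S
    obtain ⟨c, hc, hS⟩ := S.adj_center
    obtain ⟨X, hX, hiso⟩ := (hfix.ncard_eq_iff hT (hπ c hc) S).1 (hn _ (hπ c hc) S) _
      (hfix.restrict hT S)
    exact ⟨X, ⟨c, hc, hS, hX⟩, hiso⟩
  choose σ hσ β hβ hcol using hex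
  -- Branches with a common partner are at the same end and equally coloured, hence equal.
  have hinj : Function.Injective σ := by
    intro S S' hSS
    obtain ⟨c, hc, hS, hσS⟩ := hσ S
    obtain ⟨c', hc', hS', hσS'⟩ := hσ S'
    rw [hSS] at hσS
    obtain rfl : c = c' :=
      π.injective (eq_of_mem_branchesAt hT (hπ c hc) (hπ c' hc') hσS hσS')
    obtain ⟨γ, hγ, hγcol⟩ : ∃ γ : (σ S).graph ≃g (σ S').graph, γ (σ S).root = (σ S').root ∧
        ∀ x, (γ x).1.1 = x.1.1 := by
      rw [hSS]
      exact ⟨RelIso.refl _, rfl, fun _ => rfl⟩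
    refine hfix.eq_of_colourIso hT hc hS hS' ⟨((β S).trans γ).trans (β S').symm, ?_, fun x => ?_⟩
    · rw [RelIso.trans_apply, RelIso.trans_apply, hβ, hγ, ← hβ S', RelIso.symm_apply_apply]
    · have := hcol S' (((β S).trans γ).trans (β S').symm x)
      simp only [RelIso.trans_apply, RelIso.apply_symm_apply, hγcol, ← hcol S] at this
      exact this.symm
  obtain ⟨φ, hφC, hφ⟩ := exists_iso_glue hT π hπ π.injective.injOn σ hinj (by
    intro c hc S hS
    obtain ⟨c', hc', hS', h⟩ := hσ S
    rwa [eq_of_mem_branchesAt hT hc hc' hS hS']) β hβ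
  obtain ⟨v, hv, hfv⟩ := hf φ (by
    rintro rfl
    have := hφC u hu
    simp only [π, Equiv.swap_apply_left] at this
    exact huw.ne this)
  obtain ⟨X, x, rfl⟩ := Branch.exists_mem hT hv
  exact hfv (by rw [hφ]; exact hcol X x)

/-- If some colour-preserving automorphism moves the centre and a colouring `h` of a branch `S` at
`c` does not occur at `c`, then recolouring `S` by `h` destroys all such automorphisms. -/
theorem exists_offCenterDistinguishes_of_recolour [Finite V] (hT : T.IsTree) {α : Type*}
    {f : V → α} (hf : CenterFixingDistinguishes T f) {φ₀ : T ≃g T}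
    (hφ₀ : ∀ v, v ∉ T.center → f v = f (φ₀ v)) {c : V} (hc : c ∈ T.center) (hφc : φ₀ c ≠ c)
    (hC : ∀ d ∈ T.center, d = c ∨ d = φ₀ c) {S : Branch T} (hS : S ∈ branchesAt T c)
    {h : S.comp.supp → α} (hh : RootedDistinguishes S.graph S.root h)
    (hnew : ∀ X ∈ branchesAt T c, ¬ ColourIso S X h f) :
    ∃ f' : V → α, OffCenterDistinguishes T f' := by
  classical
  obtain ⟨f', hf'S, hf'⟩ : ∃ f' : V → α, (∀ x : S.comp.supp, f' x.1.1 = h x) ∧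
      ∀ v, ¬ S.Mem v → f' v = f v := by
    refine ⟨fun v => if hv : S.Mem v then h hv.choose else f v, fun x => ?_, fun v hv => ?_⟩
    · have hx := S.mem_coe x
      simp only [dif_pos hx]
      congr 1
      exact Subtype.ext (Subtype.ext hx.choose_spec)
    · simp [hv]
  have hφ₀c : φ₀ c ∈ T.center := (map_mem_center_iff φ₀).2 hc
  refine ⟨f', fun φ hφ => ?_⟩
  by_contra! hcon
  have hφc' : φ c ∈ T.center := (map_mem_center_iff φ).2 hc
  -- An image other than `S` was not recoloured, so it already displays `h` under `f`.
  have hiso : S.map φ ≠ S → ColourIso S (S.map φ) h f := by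
    intro hne
    refine ⟨mapIso φ S, mapIso_root φ S, fun x => ?_⟩
    rw [← hf'S, hcon _ x.1.2, ← mapIso_coe]
    exact hf' _ fun hm => hne (Branch.eq_of_mem hT (mem_coe _ _) hm)
  rcases hC _ hφc' with hfc | hfc
  · have hmap : S.map φ = S := by
      by_contra hne
      refine hnew _ ?_ (hiso hne)
      have := map_mem_branchesAt φ hS
      rwa [hfc] at this
    obtain ⟨β, hβ, hβφ⟩ := exists_iso_of_map_eq hmap
    have hβ1 : β = 1 := by
      by_contra hne
      obtain ⟨x, hx⟩ := hh β hβ hne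
      apply hx
      rw [← hf'S, ← hf'S, hcon _ x.1.2, hβφ]
    have hφS : ∀ v, S.Mem v → φ v = v := by
      rintro _ ⟨x, rfl⟩
      rw [← hβφ, hβ1]
      rfl
    -- Now `φ` fixes the centre and `S` pointwise, so off the centre it preserves `f` as well as
    -- `f'`.
    obtain ⟨v, hv, hfv⟩ := hf φ hφ (by
      intro d hd
      rcases hC d hd with rfl | rfl
      · exact hfc
      · rcases hC _ ((map_mem_center_iff φ).2 hd) with h | h
        · exact (hφc (φ.injective (h.trans hfc.symm))).elim
        · exact h)
    by_cases hvS : S.Mem v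
    · exact hfv (by rw [hφS v hvS])
    · have hφv : ¬ S.Mem (φ v) := fun hm => hvS (by rwa [φ.injective (hφS _ hm)] at hm)
      exact hfv (by rw [← hf' v hvS, ← hf' _ hφv, hcon v hv])
  -- If `φ` moves `c`, the image of `S` at the other end displays `h` under `f`, and `φ₀` carries it
  -- back to `c` with its colours.
  · have hat : S.map φ ∈ branchesAt T (φ₀ c) := hfc ▸ map_mem_branchesAt φ hS
    obtain ⟨β, hβ, hcol⟩ := hiso fun hmap =>
      hφc (eq_of_mem_branchesAt hT hφ₀c hc (hmap ▸ hat) hS)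
    refine hnew ((S.map φ).map φ₀) ?_ ⟨β.trans (mapIso φ₀ _), ?_, fun x => ?_⟩
    · have hback : φ₀ (φ₀ c) = c := by
        rcases hC _ ((map_mem_center_iff φ₀).2 hφ₀c) with h | h
        · exact h
        · exact (hφc (φ₀.injective h)).elim
      have := map_mem_branchesAt φ₀ hat
      rwa [hback] at this
    · simp [hβ, mapIso_root]
    · rw [hcol, RelIso.trans_apply, mapIso_coe]
      exact hφ₀ _ (β x).1.2

/-- If `f` itself fails, the automorphism unseen off the centre must move the centre, which is
therefore an edge; some colouring is then missing at one end. -/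
theorem exists_offCenterDistinguishes [Finite V] (hT : T.IsTree) {k : ℕ} {f : V → Fin k}
    (hf : Distinguishes T f)
    (hn : ∀ u w, T.Adj u w → T.center = {u, w} → ∃ c ∈ T.center, ∃ S : Branch T,
      ({X | branchSetoid T X S} ∩ branchesAt T c).ncard ≠ rootedCount S.graph S.root k) :
    ∃ f' : V → Fin k, OffCenterDistinguishes T f' := by
  by_cases hoff : OffCenterDistinguishes T f
  · exact ⟨f, hoff⟩
  have hfix := hf.centerFixing
  unfold OffCenterDistinguishes at hoff
  push Not at hoff
  obtain ⟨φ₀, hne, hφ₀⟩ := hoff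
  obtain ⟨u, w, hC, huw⟩ := hT.exists_center_eq
  have hmv : ¬ ∀ c ∈ T.center, φ₀ c = c := by
    intro h
    obtain ⟨v, hv, hfv⟩ := hfix φ₀ hne h
    exact hfv (hφ₀ v hv)
  have hu : u ∈ T.center := by simp [hC]
  have hw : w ∈ T.center := by simp [hC]
  have hu' := (map_mem_center_iff φ₀).2 hu
  have hw' := (map_mem_center_iff φ₀).2 hw
  have hmem : ∀ d, d ∈ T.center ↔ d = u ∨ d = w := fun d => by simp [hC]
  rw [hmem] at hu' hw'
  have hinj : φ₀ u = φ₀ w → u = w := fun h => φ₀.injective h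
  have hadj : T.Adj u w := huw.resolve_left (by rintro rfl; grind)
  have huw' : φ₀ u = w ∧ φ₀ w = u := by
    have := hadj.ne
    grind
  obtain ⟨c, hc, S, hcS⟩ := hn u w hadj hC
  have hφc : φ₀ c ≠ c := by
    have := hadj.ne
    rcases (hmem c).1 hc with rfl | rfl <;> grind
  have hCc : ∀ d ∈ T.center, d = c ∨ d = φ₀ c := by
    intro d hd
    rcases (hmem c).1 hc with rfl | rfl <;> rcases (hmem d).1 hd with rfl | rfl <;> grind
  rw [ne_eq, hfix.ncard_eq_iff hT hc S] at hcS
  push Not at hcS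
  obtain ⟨h, hh, hnew⟩ := hcS
  -- The branch to be recoloured must be at `c`. If `S` is at the other end, `φ₀.symm` provides an
  -- isomorphic one.
  obtain ⟨S₀, hS₀, ι, hι⟩ : ∃ S₀ ∈ branchesAt T c, ∃ ι : S₀.graph ≃g S.graph,
      ι S₀.root = S.root := by
    obtain ⟨d, hd, hS⟩ := S.adj_center
    rcases hCc d hd with rfl | rfl
    · exact ⟨S, hS, RelIso.refl _, rfl⟩
    · refine ⟨S.map φ₀.symm, ?_, (mapIso _ S).symm, ?_⟩
      · have := map_mem_branchesAt φ₀.symm (show S ∈ branchesAt T (φ₀ c) from hS)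
        rwa [RelIso.symm_apply_apply] at this
      · rw [← mapIso_root, RelIso.symm_apply_apply]
  refine exists_offCenterDistinguishes_of_recolour hT hfix hφ₀ hc hφc hCc hS₀
    (hh.comp_iso ι hι) fun X hX hiso => hnew X hX ?_
  obtain ⟨β, hβ, hcol⟩ := hiso
  refine ⟨ι.symm.trans β, by simp [← hι, hβ], fun x => ?_⟩
  simpa using hcol (ι.symm x)

/-! ### Distinguishing numbers and the main theorem. -/

theorem exists_distinguishes_distNumber {W : Type*} [Finite W] (G : SimpleGraph W) :
    ∃ f : W → Fin (distNumber G), Distinguishes G f := by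
  refine Nat.sInf_mem (s := {k : ℕ | ∃ f : W → Fin k, Distinguishes G f})
    ⟨Nat.card W, Finite.equivFin W, fun φ hφ => ?_⟩
  by_contra! h
  apply hφ
  ext v
  exact ((Finite.equivFin W).injective (h v)).symm

theorem distNumber_le_iff {W : Type*} [Finite W] {G : SimpleGraph W} {k : ℕ} :
    distNumber G ≤ k ↔ ∃ f : W → Fin k, Distinguishes G f := by
  constructor
  · intro h
    obtain ⟨f, hf⟩ := exists_distinguishes_distNumber G
    refine ⟨Fin.castLE h ∘ f, fun φ hφ => ?_⟩
    obtain ⟨v, hv⟩ := hf φ hφ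
    exact ⟨v, (Fin.castLE_injective h).ne hv⟩
  · exact fun h => Nat.sInf_le h

end TreeDist

theorem mainTheorem4 {V : Type*} [Finite V] (T : SimpleGraph V) (hT : T.IsTree)
    (hP₂ : Nat.card V ≠ 2) :
    TreeDist.distNumber T < TreeDist.distNumber T.lineGraph ↔
      ∃ u w : V, T.Adj u w ∧ T.center = {u, w} ∧
        ∀ P ∈ (TreeDist.branchSetoid T).classes, ∀ S ∈ P,
          (P ∩ TreeDist.branchesAt T u).ncard =
              TreeDist.rootedCount S.graph S.root (TreeDist.distNumber T) ∧
            (P ∩ TreeDist.branchesAt T w).ncard =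
              TreeDist.rootedCount S.graph S.root (TreeDist.distNumber T) := by
  rw [← not_le, TreeDist.distNumber_le_iff]
  rcases subsingleton_or_nontrivial V with hV | hV
  -- For a single vertex the line graph is empty, so both sides fail.
  · refine iff_of_false (not_not.2 ?_) fun ⟨u, w, huw, _⟩ => huw.ne (Subsingleton.elim u w)
    have : IsEmpty T.edgeSet := ⟨by
      rintro ⟨⟨a, b⟩, h⟩
      exact SimpleGraph.Adj.ne h (Subsingleton.elim a b)⟩
    exact ⟨isEmptyElim, fun φ hφ => (hφ (by ext e; exact isEmptyElim e)).elim⟩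
  rw [TreeDist.exists_lineGraph_distinguishes_iff hT hP₂]
  constructor
  · intro hno
    by_contra! hR
    obtain ⟨f, hf⟩ := TreeDist.exists_distinguishes_distNumber T
    refine hno (TreeDist.exists_offCenterDistinguishes hT hf fun u w huw hC => ?_)
    obtain ⟨P, hP, S, hS, h⟩ := hR u w huw hC
    have hPS : P = {X | TreeDist.branchSetoid T X S} := by
      obtain ⟨Y, rfl⟩ := hP
      ext X
      exact ⟨fun hX => (TreeDist.branchSetoid T).trans hX ((TreeDist.branchSetoid T).symm hS),
        fun hX => (TreeDist.branchSetoid T).trans hX hS⟩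
    subst hPS
    by_cases hu : ({X | TreeDist.branchSetoid T X S} ∩ TreeDist.branchesAt T u).ncard =
        TreeDist.rootedCount S.graph S.root (TreeDist.distNumber T)
    · exact ⟨w, by simp [hC], S, h hu⟩
    · exact ⟨u, by simp [hC], S, hu⟩
  · rintro ⟨u, w, huw, hC, h⟩ ⟨f, hf⟩
    refine TreeDist.not_offCenterDistinguishes hT huw hC (fun c hc S => ?_) f hf
    have := h _ (Setoid.mem_classes _ S) S ((TreeDist.branchSetoid T).refl S)
    rw [hC] at hc
    rcases hc with rfl | rfl
    · exact this.1
    · exact this.2
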